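/- **Theorem 2.1 (Strong Markov Property).** Let $W=\{W(s,t);\ s,t\ge 0\}$ be a real-valued two-parameter Brownian sheet on a probability space $(\Lambda,\mathcal G,\mathrm P)$; that is, a centered Gaussian process with $\mathrm{E}[W(s,t)W(s',t')]=\min(s,s')\min(t,t')$ all of whose sample functions $(s,t)\mapsto W(s,t)$ are continuous. For $s\ge 0$ let $\mathfrak F_{00}(s)$ be the $\sigma$-algebra generated by $\{W(r,t);\ r\in[0,s],\ t\ge 0\}$, let $\mathfrak F_0(s)$ be the $\sigma$-algebra generated by $\mathfrak F_{00}(s)$ and all $\mathrm P$-null sets (including all subsets of null sets in $\mathcal G$), and let $\mathfrak F(s):=\bigcap_{u>s}\mathfrak F_0(u)$. Let $S:\Lambda\to[0,\infty)$ be a finite stopping time for $\mathfrak F=\{\mathfrak F(s)\}_{s\ge0}$, i.e. $\{S\le s\}\in\mathfrak F(s)$ for all $s\ge0$, and let $\mathfrak F(S)$ be the $\sigma$-algebra of all $A\in\sigma(\bigcup_{s\ge 0}\mathfrak F(s))$ such that $A\cap\{S\le s\}\in\mathfrak F(s)$ for all $s\ge0$. Write $W(s,\bullet)$ for the random function $t\mapsto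 W(s,t)$, viewed as a random element of the space $C([0,\infty),\mathbb R)$ with the Borel $\sigma$-algebra of its compact-open topology. Then: 1. $W(S,\bullet)$ is $\mathfrak F(S)$-measurable; 2. the process $s\mapsto W(S+s,\bullet)-W(S,\bullet)$, $s\ge 0$ (i.e. the $\sigma$-algebra generated by all of it), is independent of $\mathfrak F(S)$; 3. this process has the same law as $s\mapsto W(s,\bullet)$, as a process indexed by $s\in[0,\infty)$ (the laws being measures on the product $\sigma$-algebra of $C([0,\infty),\mathbb R)^{[0,\infty)}$). The same three assertions hold when all functions of $t$ are restricted to $[0,1]$, that is, for the corresponding random elements of and processes in $\Omega=C([0,1],\mathbb R)$ with the Borel $\sigma$-algebra of the uniform topology. -/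

import Mathlib

open MeasureTheory ProbabilityTheory
open scoped NNReal

namespace BrownianSheet

/-- The space `C(X, ℝ)`, with its compact-open topology, carries the Borel sigma-algebra. -/
instance instMeasurableSpaceContinuousMap {X : Type*} [TopologicalSpace X] :
    MeasurableSpace C(X, ℝ) := borel _

instance instBorelSpaceContinuousMap {X : Type*} [TopologicalSpace X] :
    BorelSpace C(X, ℝ) := ⟨rfl⟩

/-- `W` is a (continuous, real-valued, two-parameter) Brownian sheet on the probability space
carrying `P`: a centered Gaussian process indexed by `[0,∞) × [0,∞)` with covariance
`E[W(s,t) W(s',t')] = min(s,s') min(t,t')` and with jointly continuous sample functions. -/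
structure IsBrownianSheet {Λ : Type*} {mΛ : MeasurableSpace Λ}
    (W : ℝ≥0 → ℝ≥0 → Λ → ℝ) (P : Measure Λ) : Prop where
  measurable : ∀ s t, Measurable (W s t)
  isGaussianProcess : IsGaussianProcess (fun p : ℝ≥0 × ℝ≥0 ↦ W p.1 p.2) P
  integral_eq_zero : ∀ s t, ∫ ω, W s t ω ∂P = 0
  covariance_eq : ∀ s t s' t',
    covariance (W s t) (W s' t') P = ((min s s' * min t t' : ℝ≥0) : ℝ)
  continuous : ∀ ω, Continuous (fun p : ℝ≥0 × ℝ≥0 ↦ W p.1 p.2 ω)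

section Sheet

variable {Λ : Type*} {mΛ : MeasurableSpace Λ} {W : ℝ≥0 → ℝ≥0 → Λ → ℝ} {P : Measure Λ}

/-- The sigma-algebra generated by the random variables `W(r,t)`, `r ∈ [0,s]`, `t ≥ 0`. -/
abbrev generatedSigma (W : ℝ≥0 → ℝ≥0 → Λ → ℝ) (s : ℝ≥0) : MeasurableSpace Λ :=
  ⨆ (r : ℝ≥0) (_ : r ≤ s) (t : ℝ≥0), MeasurableSpace.comap (W r t) inferInstance

/-- The sigma-algebra generated by `generatedSigma W s` and all the `P`-null sets (`P N = 0` refers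
to the outer measure, so subsets of measurable null sets are included). -/
abbrev completedSigma (W : ℝ≥0 → ℝ≥0 → Λ → ℝ) (P : Measure Λ) (s : ℝ≥0) : MeasurableSpace Λ :=
  generatedSigma W s ⊔ MeasurableSpace.generateFrom {N : Set Λ | P N = 0}

/-- The completion under `P` of the ambient sigma-algebra: the sets that agree with a measurable
set off a `P`-null set. -/
abbrev completeSigma (P : Measure Λ) : MeasurableSpace Λ :=
  eventuallyMeasurableSpace mΛ (ae P)

lemma completedSigma_mono {s u : ℝ≥0} (h : s ≤ u) :
    completedSigma W P s ≤ completedSigma W P u :=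
  sup_le_sup_right
    (iSup₂_le fun r hr ↦ le_iSup₂_of_le (f := fun (r : ℝ≥0) (_ : r ≤ u) ↦
      ⨆ t : ℝ≥0, MeasurableSpace.comap (W r t) inferInstance) r (hr.trans h) le_rfl) _

lemma completedSigma_le (hW : IsBrownianSheet W P) (s : ℝ≥0) :
    completedSigma W P s ≤ completeSigma P := by
  refine sup_le ?_ (MeasurableSpace.generateFrom_le fun N hN ↦ ?_)
  · refine iSup₂_le fun r _ ↦ iSup_le fun t ↦ ?_
    exact (hW.measurable r t).comap_le.trans (le_eventuallyMeasurableSpace)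
  · exact ⟨∅, MeasurableSet.empty, ae_eq_empty.2 hN⟩

/-- The completed filtration of the sheet in its first variable, before it is made
right-continuous. -/
def completedFiltration (hW : IsBrownianSheet W P) : Filtration ℝ≥0 (completeSigma P) where
  seq s := completedSigma W P s
  mono' _ _ h := completedSigma_mono h
  le' s := completedSigma_le hW s

/-- The filtration `𝔉` of the sheet in its first variable, completed and right-continuous. -/
noncomputable def sheetFiltration (hW : IsBrownianSheet W P) :
    Filtration ℝ≥0 (completeSigma P) :=
  (completedFiltration hW).rightCont

lemma sheetFiltration_apply (hW : IsBrownianSheet W P) (s : ℝ≥0) :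
    sheetFiltration hW s = ⨅ u > s, completedSigma W P u :=
  (completedFiltration hW).rightCont_eq s

/-- The continuous function `t ↦ W(s,t)`, `t ≥ 0`, that is, `W(s,•)`. -/
def slice (hW : IsBrownianSheet W P) (s : ℝ≥0) (ω : Λ) : C(ℝ≥0, ℝ) where
  toFun t := W s t ω
  continuous_toFun := (hW.continuous ω).comp (Continuous.prodMk_right s)

/-- The post-`S` increment process `s ↦ W(S+s,•) - W(S,•)`, for a random time `S`. -/
def increment (hW : IsBrownianSheet W P) (S : Λ → ℝ≥0) (ω : Λ) (s : ℝ≥0) : C(ℝ≥0, ℝ) :=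
  slice hW (S ω + s) ω - slice hW (S ω) ω

end Sheet

/-- The space of continuous functions from `[0,1]` to `ℝ`. -/
abbrev WienerSpace : Type := C(Set.Icc (0 : ℝ≥0) 1, ℝ)

/-- The restriction to `[0,1]` of a continuous function on `[0,∞)`. -/
def toWiener (f : C(ℝ≥0, ℝ)) : WienerSpace := f.restrict (Set.Icc 0 1)

end BrownianSheet

/-! For a deterministic time `q`, the increments after `q` are jointly Gaussian with the past,
uncorrelated with it, and have the covariance of the sheet. Hence they are independent of the past
and distributed like the sheet, and adjoining null sets to the past changes nothing
(`setIntegral_shiftedSheet`).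

For a stopping time, approximate `S` from above by grid times with countably many values. If `A` is
in the past of `S`, the part of `A` where the grid time equals `q` lies in the completed past of
`q`, so the deterministic case applies there and summing over `q` covers `A`. Continuity of the
sheet lets the mesh tend to zero: under `P.restrict A` the increments after `S` have `P A` times the
law of the sheet (`map_increment`). Taking `A` to be everything gives the law, general `A` the
independence. Finite-dimensional laws suffice because evaluations generate the Borel sets of `C(X,
ℝ)`. The claims on `[0,1]` follow by applying the measurable restriction map. -/

namespace BrownianSheet

/-! ### Borel sets of spaces of continuous functions -/

section ContinuousMap

variable {X : Type*} [TopologicalSpace X]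

/-- Mapping a set into an open set of reals is a countable condition on a continuous function. -/
lemma mapsTo_iff_exists_le_infEDist {K D : Set X} (hK : IsCompact K) (hDK : D ⊆ K)
    (hKD : K ⊆ closure D) {U : Set ℝ} (hU : IsOpen U) (f : C(X, ℝ)) :
    Set.MapsTo f K U ↔
      ∃ n : ℕ, ∀ d ∈ D, ((n : ENNReal) + 1)⁻¹ ≤ Metric.infEDist (f d) Uᶜ := by
  constructor
  · intro h
    -- The image of `K` is compact in the open set `U`, so it keeps a uniform distance from the
    -- complement.
    obtain ⟨δ, hδ, hδU⟩ := (hK.image f.continuous).exists_thickening_subset_open hU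
      (Set.mapsTo_iff_image_subset.1 h)
    obtain ⟨n, hn⟩ := ENNReal.exists_inv_nat_lt (a := ENNReal.ofReal δ) (by simpa using hδ)
    refine ⟨n, fun d hd ↦ Metric.le_infEDist.2 fun y hy ↦ ?_⟩
    have hle : ((n : ENNReal) + 1)⁻¹ ≤ ENNReal.ofReal δ :=
      (ENNReal.inv_le_inv.2 (by simp)).trans hn.le
    refine hle.trans (le_of_not_gt fun hlt ↦ hy (hδU ?_))
    rw [Metric.mem_thickening_iff_infEDist_lt]
    refine (Metric.infEDist_le_edist_of_mem (Set.mem_image_of_mem f (hDK hd))).trans_lt ?_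
    rwa [edist_comm]
  · rintro ⟨n, hn⟩ x hx
    -- The bound is a closed condition, so it passes from `D` to its closure; a positive bound then
    -- keeps `f x` inside `U`.
    have hclosed : IsClosed {x | ((n : ENNReal) + 1)⁻¹ ≤ Metric.infEDist (f x) Uᶜ} :=
      isClosed_le continuous_const (Metric.continuous_infEDist.comp f.continuous)
    have hle : ((n : ENNReal) + 1)⁻¹ ≤ Metric.infEDist (f x) Uᶜ :=
      closure_minimal (fun d hd ↦ hn d hd) hclosed (hKD hx)
    by_contra hxU
    rw [Metric.infEDist_zero_of_mem hxU, nonpos_iff_eq_zero, ENNReal.inv_eq_zero] at hle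
    exact absurd hle (by finiteness)

/-- The Borel sigma-algebra of the compact-open topology is generated by the evaluations. -/
lemma borel_continuousMap_eq_iSup_comap_eval [SecondCountableTopology X]
    [LocallyCompactSpace X] :
    (borel C(X, ℝ)) = ⨆ x : X, MeasurableSpace.comap (fun f : C(X, ℝ) ↦ f x) inferInstance := by
  apply le_antisymm
  · rw [borel_eq_generateFrom_of_subbasis (ContinuousMap.compactOpen_eq (X := X) (Y := ℝ))]
    refine MeasurableSpace.generateFrom_le ?_
    rintro _ ⟨K, hK, U, hU, rfl⟩
    obtain ⟨D, hDc, hKD⟩ := TopologicalSpace.exists_countable_dense K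
    simp only [mapsTo_iff_exists_le_infEDist hK (Subtype.coe_image_subset K D)
      (Subtype.dense_iff.1 hKD) hU, Set.ofPred_exists, Set.ofPred_forall]
    refine MeasurableSet.iUnion fun n ↦ MeasurableSet.biInter (hDc.image _) fun d _ ↦ ?_
    have hd : Measurable[⨆ x : X, MeasurableSpace.comap (fun f : C(X, ℝ) ↦ f x) inferInstance]
        (fun f : C(X, ℝ) ↦ f d) :=
      (comap_measurable _).mono (le_iSup (fun x : X ↦
        MeasurableSpace.comap (fun f : C(X, ℝ) ↦ f x) inferInstance) d) le_rfl
    exact (Metric.continuous_infEDist.measurable.comp hd) measurableSet_Ici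
  · refine iSup_le fun x ↦ Measurable.comap_le ?_
    exact (continuous_eval_const x).borel_measurable

lemma measurable_continuousMap [SecondCountableTopology X] [LocallyCompactSpace X] {Ω : Type*}
    {m : MeasurableSpace Ω} {g : Ω → C(X, ℝ)} (h : ∀ x, Measurable fun ω ↦ g ω x) : Measurable g := by
  rw [measurable_iff_comap_le]
  change (borel _).comap g ≤ m
  rw [borel_continuousMap_eq_iSup_comap_eval, MeasurableSpace.comap_iSup, iSup_le_iff]
  intro x
  rw [MeasurableSpace.comap_comp]
  exact (h x).comap_le

/-- The product sigma-algebra on processes with values in `C(X, ℝ)` is generated by the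
evaluations at pairs of an index and a point. -/
lemma pi_continuousMap_le_comap_uncurry [SecondCountableTopology X] [LocallyCompactSpace X]
    {ι : Type*} :
    (MeasurableSpace.pi : MeasurableSpace (ι → C(X, ℝ))) ≤
      MeasurableSpace.comap (fun f (p : ι × X) ↦ f p.1 p.2) MeasurableSpace.pi := by
  refine iSup_le fun i ↦ ?_
  rw [← measurable_iff_comap_le]
  refine @measurable_continuousMap _ _ _ _ _ (_) _ fun x ↦ ?_
  exact (measurable_pi_apply (i, x)).comp
    (comap_measurable fun (f : ι → C(X, ℝ)) (p : ι × X) ↦ f p.1 p.2)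

end ContinuousMap

/-! ### Gaussian laws from mean and covariance -/

section Gaussian

variable {Ω Ω' T : Type*} {mΩ : MeasurableSpace Ω} {mΩ' : MeasurableSpace Ω'} {P : Measure Ω}
  {Q : Measure Ω'}

/-- The finite-dimensional laws of a real Gaussian process are determined by its mean and its
covariance. -/
lemma map_restrict_eq_of_isGaussianProcess {X : T → Ω → ℝ} {Y : T → Ω' → ℝ}
    (hX : IsGaussianProcess X P) (hY : IsGaussianProcess Y Q)
    (hm : ∀ t, ∫ ω, X t ω ∂P = ∫ ω, Y t ω ∂Q)
    (hc : ∀ s t, covariance (X s) (X t) P = covariance (Y s) (Y t) Q) (I : Finset T) :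
    P.map (fun ω ↦ I.restrict (X · ω)) = Q.map (fun ω ↦ I.restrict (Y · ω)) := by
  have := hX.isProbabilityMeasure
  have := hY.isProbabilityMeasure
  have mX : AEMeasurable (fun ω ↦ I.restrict (X · ω)) P :=
    aemeasurable_pi_lambda _ fun i ↦ hX.aemeasurable i
  have mY : AEMeasurable (fun ω ↦ I.restrict (Y · ω)) Q :=
    aemeasurable_pi_lambda _ fun i ↦ hY.aemeasurable i
  have := (hX.hasGaussianLaw I).isGaussian_map
  have := (hY.hasGaussianLaw I).isGaussian_map
  -- The characteristic function of a Gaussian law at `L` depends only on the mean and variance of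
  -- `L`; expanding `L` in coordinates reduces these to `hm` and `hc`.
  refine Measure.ext_of_charFunDual (funext fun L ↦ ?_)
  classical
  have hL (x : I → ℝ) : L x = ∑ i, L (Pi.single i 1) * x i := by
    conv_lhs => rw [← Finset.univ_sum_single x, map_sum]
    refine Finset.sum_congr rfl fun i _ ↦ ?_
    rw [← mul_one (x i), ← smul_eq_mul, Pi.single_smul, map_smul]
    simp [mul_comm]
  have hXL : (fun ω ↦ L (I.restrict (X · ω))) =
      fun ω ↦ ∑ i : I, L (Pi.single i 1) * X i ω := by
    ext ω; simp [hL (I.restrict (X · ω))]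
  have hYL : (fun ω ↦ L (I.restrict (Y · ω))) =
      fun ω ↦ ∑ i : I, L (Pi.single i 1) * Y i ω := by
    ext ω; simp [hL (I.restrict (Y · ω))]
  have hXm (i : I) : MemLp (fun ω ↦ L (Pi.single i 1) * X i ω) 2 P :=
    (hX.hasGaussianLaw_eval i).memLp_two.const_mul _
  have hYm (i : I) : MemLp (fun ω ↦ L (Pi.single i 1) * Y i ω) 2 Q :=
    (hY.hasGaussianLaw_eval i).memLp_two.const_mul _
  have hmean : ∫ ω, L (I.restrict (X · ω)) ∂P = ∫ ω, L (I.restrict (Y · ω)) ∂Q := by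
    rw [hXL, hYL]
    rw [integral_finsetSum _ fun i _ ↦ (hXm i).integrable one_le_two,
      integral_finsetSum _ fun i _ ↦ (hYm i).integrable one_le_two]
    simp only [integral_const_mul, hm]
  have hvar : Var[fun ω ↦ L (I.restrict (X · ω)); P] = Var[fun ω ↦ L (I.restrict (Y · ω)); Q] := by
    rw [hXL, hYL, variance_fun_sum hXm, variance_fun_sum hYm]
    refine Finset.sum_congr rfl fun i _ ↦ Finset.sum_congr rfl fun j _ ↦ ?_
    rw [covariance_const_mul_left (X := X i), covariance_const_mul_right (Y := X j),
      covariance_const_mul_left (X := Y i), covariance_const_mul_right (Y := Y j), hc]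
  rw [IsGaussian.charFunDual_eq, IsGaussian.charFunDual_eq,
    integral_map mX (by fun_prop), integral_map mY (by fun_prop),
    variance_map (by fun_prop) mX, variance_map (by fun_prop) mY, integral_complex_ofReal,
    integral_complex_ofReal, hmean, Function.comp_def, Function.comp_def, hvar]

end Gaussian

open Filter Topology

/-! ### Markov property at deterministic times -/

section Shift

variable {Λ : Type*} {mΛ : MeasurableSpace Λ} {W : ℝ≥0 → ℝ≥0 → Λ → ℝ} {P : Measure Λ}

/-- The increment of the sheet after the deterministic time `q`. -/
def shiftedSheet (W : ℝ≥0 → ℝ≥0 → Λ → ℝ) (q : ℝ≥0) (p : ℝ≥0 × ℝ≥0) (ω : Λ) : ℝ :=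
  W (q + p.1) p.2 ω - W q p.2 ω

lemma IsBrownianSheet.measurable_shiftedSheet (hW : IsBrownianSheet W P) (q : ℝ≥0)
    (p : ℝ≥0 × ℝ≥0) : Measurable (shiftedSheet W q p) :=
  (hW.measurable _ _).sub (hW.measurable _ _)

/-- Every member is a linear function of at most two sheet values. Joint Gaussianity is what turns
zero covariance into independence. -/
lemma IsBrownianSheet.isGaussianProcess_past_shiftedSheet (hW : IsBrownianSheet W P) (q : ℝ≥0) :
    IsGaussianProcess (Sum.elim
      (fun (p : {p : ℝ≥0 × ℝ≥0 // p.1 ≤ q}) ↦ W p.1.1 p.1.2) (shiftedSheet W q)) P := by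
  classical
  refine hW.isGaussianProcess.of_isGaussianProcess ?_
  rintro (p | p)
  · exact ⟨{p.1}, ContinuousLinearMap.proj ⟨p.1, by simp⟩, fun ω ↦ rfl⟩
  · exact ⟨{(q + p.1, p.2), (q, p.2)}, ContinuousLinearMap.proj ⟨(q + p.1, p.2), by simp⟩ -
      ContinuousLinearMap.proj ⟨(q, p.2), by simp⟩, fun ω ↦ rfl⟩

lemma IsBrownianSheet.isGaussianProcess_shiftedSheet (hW : IsBrownianSheet W P) (q : ℝ≥0) :
    IsGaussianProcess (shiftedSheet W q) P :=
  (hW.isGaussianProcess_past_shiftedSheet q).comp_right Sum.inr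

lemma IsBrownianSheet.memLp_two (hW : IsBrownianSheet W P) (s t : ℝ≥0) : MemLp (W s t) 2 P :=
  (hW.isGaussianProcess.hasGaussianLaw_eval (s, t)).memLp_two

lemma IsBrownianSheet.covariance_shiftedSheet_right [IsProbabilityMeasure P]
    (hW : IsBrownianSheet W P) (q r t : ℝ≥0) (p : ℝ≥0 × ℝ≥0) :
    covariance (W r t) (shiftedSheet W q p) P =
      ((min r (q + p.1) * min t p.2 : ℝ≥0) : ℝ) - ((min r q * min t p.2 : ℝ≥0) : ℝ) := by
  change covariance (W r t) (W (q + p.1) p.2 - W q p.2) P = _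
  rw [covariance_sub_right (hW.memLp_two _ _) (hW.memLp_two _ _) (hW.memLp_two _ _),
    hW.covariance_eq, hW.covariance_eq]

lemma IsBrownianSheet.covariance_past_shiftedSheet [IsProbabilityMeasure P]
    (hW : IsBrownianSheet W P) {q r : ℝ≥0} (hr : r ≤ q) (t : ℝ≥0) (p : ℝ≥0 × ℝ≥0) :
    covariance (W r t) (shiftedSheet W q p) P = 0 := by
  rw [hW.covariance_shiftedSheet_right, min_eq_left hr, min_eq_left (hr.trans le_self_add),
    sub_self]

/-- The term `W q p.2` belongs to the past and drops out; what remains uses `min (q + a) (q + b) - q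
= min a b`. -/
lemma IsBrownianSheet.covariance_shiftedSheet [IsProbabilityMeasure P]
    (hW : IsBrownianSheet W P) (q : ℝ≥0) (p p' : ℝ≥0 × ℝ≥0) :
    covariance (shiftedSheet W q p) (shiftedSheet W q p') P =
      covariance (W p.1 p.2) (W p'.1 p'.2) P := by
  have hV : MemLp (shiftedSheet W q p') 2 P := (hW.memLp_two _ _).sub (hW.memLp_two _ _)
  change covariance (W (q + p.1) p.2 - W q p.2) _ P = _
  rw [covariance_sub_left (hW.memLp_two _ _) (hW.memLp_two _ _) hV,
    hW.covariance_past_shiftedSheet le_rfl,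
    hW.covariance_shiftedSheet_right, hW.covariance_eq, min_add_add_left,
    min_eq_right (le_self_add : q ≤ q + p.1)]
  push_cast
  ring

/-- The increments after a deterministic time have the finite-dimensional laws of the sheet. -/
lemma IsBrownianSheet.map_restrict_shiftedSheet [IsProbabilityMeasure P]
    (hW : IsBrownianSheet W P) (q : ℝ≥0) (I : Finset (ℝ≥0 × ℝ≥0)) :
    P.map (fun ω ↦ I.restrict (shiftedSheet W q · ω)) =
      P.map (fun ω ↦ I.restrict (fun p : ℝ≥0 × ℝ≥0 ↦ W p.1 p.2 ω)) := by
  refine map_restrict_eq_of_isGaussianProcess (hW.isGaussianProcess_shiftedSheet q)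
    hW.isGaussianProcess (fun p ↦ ?_) (fun p p' ↦ hW.covariance_shiftedSheet q p p') I
  simp only [shiftedSheet]
  rw [integral_sub ((hW.memLp_two _ _).integrable one_le_two)
    ((hW.memLp_two _ _).integrable one_le_two)]
  simp [hW.integral_eq_zero]

lemma generatedSigma_le (hW : IsBrownianSheet W P) (q : ℝ≥0) : generatedSigma W q ≤ mΛ :=
  iSup₂_le fun r _ ↦ iSup_le fun t ↦ (hW.measurable r t).comap_le

/-- The increments after a deterministic time are independent of the past. -/
lemma IsBrownianSheet.indep_generatedSigma_shiftedSheet [IsProbabilityMeasure P]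
    (hW : IsBrownianSheet W P) (q : ℝ≥0) :
    Indep (generatedSigma W q)
      (MeasurableSpace.comap (fun ω p ↦ shiftedSheet W q p ω) MeasurableSpace.pi) P := by
  have h := (hW.isGaussianProcess_past_shiftedSheet q).indepFun_of_covariance_eq_zero
    (fun p ↦ (hW.measurable _ _).aemeasurable)
    (fun p ↦ (hW.measurable_shiftedSheet q p).aemeasurable)
    (fun p p' ↦ hW.covariance_past_shiftedSheet p.2 p.1.2 p')
  refine indep_of_indep_of_le_left h (iSup₂_le fun r hr ↦ iSup_le fun t ↦ ?_)
  exact ((measurable_pi_apply (⟨(r, t), hr⟩ : {p : ℝ≥0 × ℝ≥0 // p.1 ≤ q})).comp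
    (comap_measurable fun ω (p : {p : ℝ≥0 × ℝ≥0 // p.1 ≤ q}) ↦ W p.1.1 p.1.2 ω)).comap_le

lemma completedSigma_le_eventuallyMeasurableSpace (q : ℝ≥0) :
    completedSigma W P q ≤ @eventuallyMeasurableSpace _ (generatedSigma W q) (ae P) _ :=
  sup_le (@le_eventuallyMeasurableSpace _ (generatedSigma W q) _ _) <|
    MeasurableSpace.generateFrom_le fun _ hN ↦
    ⟨∅, @MeasurableSet.empty _ (generatedSigma W q), ae_eq_empty.2 hN⟩

/-- The simple Markov property, for the completed past. -/
lemma IsBrownianSheet.setIntegral_shiftedSheet [IsProbabilityMeasure P] (hW : IsBrownianSheet W P)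
    {q : ℝ≥0} {B : Set Λ} (hB : MeasurableSet[completedSigma W P q] B)
    (I : Finset (ℝ≥0 × ℝ≥0)) {f : (I → ℝ) → ℝ} (hf : Measurable f) :
    ∫ ω in B, f (I.restrict (shiftedSheet W q · ω)) ∂P =
      P.real B * ∫ ω, f (I.restrict (fun p : ℝ≥0 × ℝ≥0 ↦ W p.1 p.2 ω)) ∂P := by
  obtain ⟨B', hB', hBB'⟩ := completedSigma_le_eventuallyMeasurableSpace q B hB
  have mV : Measurable fun ω ↦ (shiftedSheet W q · ω) :=
    measurable_pi_lambda _ (hW.measurable_shiftedSheet q)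
  have mVI : Measurable fun ω ↦ I.restrict (shiftedSheet W q · ω) :=
    (Finset.measurable_restrict I).comp mV
  have mWI : Measurable fun ω ↦ I.restrict (fun p : ℝ≥0 × ℝ≥0 ↦ W p.1 p.2 ω) :=
    measurable_pi_lambda _ fun p ↦ hW.measurable _ _
  have hfI : Measurable fun x : ℝ≥0 × ℝ≥0 → ℝ ↦ f (I.restrict x) :=
    hf.comp (Finset.measurable_restrict I)
  have hset := (hW.indep_generatedSigma_shiftedSheet q).setIntegral_eq_mul
    (generatedSigma_le hW q) mV.aemeasurable hB' hfI.aestronglyMeasurable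
  rw [setIntegral_congr_set hBB', measureReal_congr hBB', hset,
    ← integral_map mVI.aemeasurable hf.aestronglyMeasurable, hW.map_restrict_shiftedSheet,
    integral_map mWI.aemeasurable hf.aestronglyMeasurable]

end Shift

/-! ### Passage to stopping times -/

section StoppingTime

variable {Λ : Type*} {mΛ : MeasurableSpace Λ} {W : ℝ≥0 → ℝ≥0 → Λ → ℝ} {P : Measure Λ}
  {S : Λ → ℝ≥0}

lemma measurable_slice_stoppingTime (hW : IsBrownianSheet W P)
    (hS : IsStoppingTime (sheetFiltration hW) (fun ω ↦ (S ω : WithTop ℝ≥0))) :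
    Measurable[hS.measurableSpace] (fun ω ↦ slice hW (S ω) ω) := by
  refine @measurable_continuousMap _ _ _ _ _ hS.measurableSpace _ fun t ↦ ?_
  have hadapted : StronglyAdapted (sheetFiltration hW) (fun s ↦ W s t) := fun s ↦ by
    refine Measurable.stronglyMeasurable ?_
    rw [sheetFiltration_apply, measurable_iff_comap_le]
    refine le_iInf₂ fun u hu ↦ le_sup_of_le_left ?_
    exact le_iSup₂_of_le (f := fun (r : ℝ≥0) (_ : r ≤ u) ↦
      ⨆ t : ℝ≥0, MeasurableSpace.comap (W r t) inferInstance) s hu.le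
      (le_iSup (fun t ↦ MeasurableSpace.comap (W s t) inferInstance) t)
  -- Adapted with continuous paths implies progressively measurable, which makes the value at `S`
  -- measurable for the past of `S`.
  exact measurable_stoppedValue (hadapted.isStronglyProgressive_of_continuous fun ω ↦
    (hW.continuous ω).comp (Continuous.prodMk_left t)) hS

/-- The filtration lives in the completion of `mΛ`, so `S` is only null-measurable; this yields a
measurable version of it. -/
lemma aemeasurable_stoppingTime (hW : IsBrownianSheet W P)
    (hS : IsStoppingTime (sheetFiltration hW) (fun ω ↦ (S ω : WithTop ℝ≥0))) :
    AEMeasurable S P := by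
  refine NullMeasurable.aemeasurable ?_
  refine measurable_of_Iic (mδ := completeSigma P) fun s ↦ ?_
  have heq : S ⁻¹' Set.Iic s = {ω | (S ω : WithTop ℝ≥0) ≤ s} := by
    ext ω; exact (WithTop.coe_le_coe (a := s) (b := S ω)).symm
  rw [heq]
  exact (sheetFiltration hW).le s _ (hS.measurableSet_le s)

lemma aemeasurable_increment (hW : IsBrownianSheet W P) (hS : AEMeasurable S P) :
    AEMeasurable (fun ω ↦ increment hW S ω) P := by
  refine ⟨fun ω ↦ increment hW (hS.mk S) ω, measurable_pi_lambda _ fun s ↦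
    measurable_continuousMap fun t ↦ ?_, ?_⟩
  · have hmeas : Measurable fun x : ℝ≥0 × Λ ↦ W x.1 t x.2 :=
      measurable_uncurry_of_continuous_of_measurable (u := fun s ω ↦ W s t ω)
        (fun ω ↦ (hW.continuous ω).comp (Continuous.prodMk_left t)) fun s ↦ hW.measurable s t
    exact (hmeas.comp ((hS.measurable_mk.add_const s).prodMk measurable_id)).sub
      (hmeas.comp (hS.measurable_mk.prodMk measurable_id))
  · filter_upwards [hS.ae_eq_mk] with ω hω
    funext s
    simp only [increment, hω]

/-- The part of an event of the past of `S` on which `S < q` belongs to the completed past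
of `q`. -/
lemma measurableSet_inter_lt (hW : IsBrownianSheet W P)
    (hS : IsStoppingTime (sheetFiltration hW) (fun ω ↦ (S ω : WithTop ℝ≥0))) {A : Set Λ}
    (hA : MeasurableSet[hS.measurableSpace] A) (q : ℝ≥0) :
    MeasurableSet[completedSigma W P q] (A ∩ {ω | S ω < q}) := by
  obtain ⟨D, hDc, hD⟩ := TopologicalSpace.exists_countable_dense ℝ≥0
  have heq : A ∩ {ω | S ω < q} = ⋃ r ∈ D ∩ Set.Iio q, A ∩ {ω | S ω ≤ r} := by
    ext ω
    simp only [Set.mem_inter_iff, Set.mem_ofPred_eq, Set.mem_iUnion, Set.mem_Iio, exists_prop]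
    constructor
    · rintro ⟨hωA, hω⟩
      obtain ⟨r, hr, hωr, hrq⟩ := hD.exists_between hω
      exact ⟨r, ⟨hr, hrq⟩, hωA, hωr.le⟩
    · rintro ⟨r, ⟨_, hrq⟩, hωA, hωr⟩
      exact ⟨hωA, hωr.trans_lt hrq⟩
  rw [heq]
  refine MeasurableSet.biUnion (hDc.mono Set.inter_subset_left) fun r hr ↦ ?_
  have h := hA.2 r
  rw [sheetFiltration_apply] at h
  -- The strict inequality `r < q` absorbs the right limit: `𝔉(r)` is contained in the completed
  -- past of `q`.
  have h' := iInf₂_le (f := fun (u : ℝ≥0) (_ : u > r) ↦ completedSigma W P u) q hr.2 _ h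
  simpa only [WithTop.coe_le_coe] using h'

/-- The discretization of `S` from above, with mesh `1 / (n + 1)`. -/
noncomputable def gridTime (S : Λ → ℝ≥0) (n : ℕ) (ω : Λ) : ℝ≥0 :=
  -- The `+ 1` puts the grid time strictly above `S`, so its level sets are differences of events `S
  -- < q`.
  ((⌊(n + 1) * S ω⌋₊ + 1 : ℕ) : ℝ≥0) / (n + 1)

lemma tendsto_gridTime (S : Λ → ℝ≥0) (ω : Λ) :
    Tendsto (fun n ↦ gridTime S n ω) atTop (𝓝 (S ω)) := by
  have hlim : Tendsto (fun n : ℕ ↦ S ω + 1 / ((n : ℝ≥0) + 1)) atTop (𝓝 (S ω)) := by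
    simpa using (tendsto_const_nhds (x := S ω)).add
      (tendsto_one_div_add_atTop_nhds_zero_nat (𝕜 := ℝ≥0))
  refine tendsto_of_tendsto_of_tendsto_of_le_of_le tendsto_const_nhds hlim (fun n ↦ ?_)
    fun n ↦ ?_
  · have := Nat.lt_floor_add_one (((n : ℝ≥0) + 1) * S ω)
    rw [gridTime, le_div_iff₀ (by positivity), mul_comm]
    push_cast
    exact this.le
  · have := Nat.floor_le (zero_le (a := ((n : ℝ≥0) + 1) * S ω))
    rw [gridTime, div_le_iff₀ (by positivity), add_mul (S ω), div_mul_cancel₀ _ (by positivity),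
      mul_comm (S ω)]
    push_cast
    gcongr

/-- The event that `gridTime S n` takes its `k`-th value. -/
lemma measurableSet_inter_floor_eq (hW : IsBrownianSheet W P)
    (hS : IsStoppingTime (sheetFiltration hW) (fun ω ↦ (S ω : WithTop ℝ≥0))) {A : Set Λ}
    (hA : MeasurableSet[hS.measurableSpace] A) (n k : ℕ) :
    MeasurableSet[completedSigma W P (((k + 1 : ℕ) : ℝ≥0) / (n + 1))]
      (A ∩ {ω | ⌊((n : ℝ≥0) + 1) * S ω⌋₊ = k}) := by
  have heq : A ∩ {ω | ⌊((n : ℝ≥0) + 1) * S ω⌋₊ = k} =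
      (A ∩ {ω | S ω < ((k + 1 : ℕ) : ℝ≥0) / (n + 1)}) \ (A ∩ {ω | S ω < (k : ℝ≥0) / (n + 1)}) := by
    ext ω
    have hn : 0 < (n : ℝ≥0) + 1 := by positivity
    simp only [Set.mem_inter_iff, Set.mem_ofPred_eq, Set.mem_sdiff, lt_div_iff₀ hn,
      mul_comm (S ω), not_and, not_lt, Nat.floor_eq_iff zero_le]
    push_cast
    tauto
  rw [heq]
  refine (measurableSet_inter_lt hW hS hA _).diff
    (completedSigma_mono ?_ _ (measurableSet_inter_lt hW hS hA _))
  push_cast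
  gcongr
  exact le_self_add

/-- The Markov property at the discretized stopping times. -/
lemma setIntegral_shiftedSheet_gridTime [IsProbabilityMeasure P] (hW : IsBrownianSheet W P)
    (hS : IsStoppingTime (sheetFiltration hW) (fun ω ↦ (S ω : WithTop ℝ≥0))) {A : Set Λ}
    (hA : MeasurableSet[hS.measurableSpace] A) (n : ℕ) (I : Finset (ℝ≥0 × ℝ≥0))
    {f : (I → ℝ) → ℝ} (hf : Measurable f)
    (hint : Integrable (fun ω ↦ f (I.restrict (shiftedSheet W (gridTime S n ω) · ω))) P) :
    ∫ ω in A, f (I.restrict (shiftedSheet W (gridTime S n ω) · ω)) ∂P =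
      P.real A * ∫ ω, f (I.restrict (fun p : ℝ≥0 × ℝ≥0 ↦ W p.1 p.2 ω)) ∂P := by
  set B : ℕ → Set Λ := fun k ↦ A ∩ {ω | ⌊((n : ℝ≥0) + 1) * S ω⌋₊ = k}
  have hB (k : ℕ) : MeasurableSet[completedSigma W P (((k + 1 : ℕ) : ℝ≥0) / (n + 1))] (B k) :=
    measurableSet_inter_floor_eq hW hS hA n k
  have hBnull (k : ℕ) : NullMeasurableSet (B k) P := completedSigma_le hW _ _ (hB k)
  have hUnion : ⋃ k, B k = A := by ext; simp [B]
  have hdisj : Pairwise (Function.onFun (AEDisjoint P) B) := fun j k hjk ↦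
    Disjoint.aedisjoint (Set.disjoint_left.2 fun ω hj hk ↦ hjk (hj.2.symm.trans hk.2))
  have hBint (k : ℕ) : ∫ ω in B k, f (I.restrict (shiftedSheet W (gridTime S n ω) · ω)) ∂P =
      P.real (B k) * ∫ ω, f (I.restrict (fun p : ℝ≥0 × ℝ≥0 ↦ W p.1 p.2 ω)) ∂P := by
    rw [← hW.setIntegral_shiftedSheet (hB k) I hf]
    refine integral_congr_ae ((ae_restrict_iff'₀ (hBnull k)).2 (ae_of_all _ fun ω hω ↦ ?_))
    have hω' : ⌊((n : ℝ≥0) + 1) * S ω⌋₊ = k := hω.2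
    simp only [gridTime, hω']
  have h1 := hasSum_integral_iUnion_ae hBnull hdisj hint.integrableOn
  -- Integrating the constant `1` shows that the `P.real (B k)` sum to `P.real A`.
  have h2 := hasSum_integral_iUnion_ae hBnull hdisj
    (integrable_const (1 : ℝ) (μ := P)).integrableOn
  simp only [hBint, hUnion] at h1
  simp only [hUnion, integral_const, smul_eq_mul, mul_one, measureReal_restrict_apply_univ] at h2
  exact h1.unique (h2.mul_right _)

/-- Conditionally on an event of the past of `S`, the increments after `S` have the
finite-dimensional laws of the sheet. -/
lemma map_restrict_increment [IsProbabilityMeasure P] (hW : IsBrownianSheet W P)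
    (hS : IsStoppingTime (sheetFiltration hW) (fun ω ↦ (S ω : WithTop ℝ≥0))) {A : Set Λ}
    (hA : MeasurableSet[hS.measurableSpace] A) (I : Finset (ℝ≥0 × ℝ≥0)) :
    (P.restrict A).map (fun ω ↦ I.restrict (shiftedSheet W (S ω) · ω)) =
      P A • P.map (fun ω ↦ I.restrict (fun p : ℝ≥0 × ℝ≥0 ↦ W p.1 p.2 ω)) := by
  have hSm := aemeasurable_stoppingTime hW hS
  have hmeas (T : Λ → ℝ≥0) (hT : AEMeasurable T P) :
      AEMeasurable (fun ω ↦ I.restrict (shiftedSheet W (T ω) · ω)) P :=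
    aemeasurable_pi_lambda _ fun p ↦
      ((continuous_eval_const _).measurable.comp
        (measurable_pi_apply p.1.1)).comp_aemeasurable (aemeasurable_increment hW hT)
  have hgrid (n : ℕ) : AEMeasurable (gridTime S n) P := by
    have : Measurable fun x : ℝ≥0 ↦ ((⌊((n : ℝ≥0) + 1) * x⌋₊ + 1 : ℕ) : ℝ≥0) / (n + 1) := by
      fun_prop
    exact this.comp_aemeasurable hSm
  have mW : Measurable fun ω ↦ I.restrict (fun p : ℝ≥0 × ℝ≥0 ↦ W p.1 p.2 ω) :=
    measurable_pi_lambda _ fun p ↦ hW.measurable _ _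
  -- Bounded continuous test functions determine a finite measure and allow dominated convergence
  -- along the grid times.
  refine @ext_of_forall_integral_eq_of_IsFiniteMeasure _ _ _ _ _ _ _ _ ?_ fun f ↦ ?_
  · exact Measure.smul_finite _ (measure_ne_top P A)
  rw [integral_map (hmeas S hSm).restrict f.continuous.aestronglyMeasurable,
    integral_smul_measure, integral_map mW.aemeasurable f.continuous.aestronglyMeasurable]
  have hint (T : Λ → ℝ≥0) (hT : AEMeasurable T P) :
      Integrable (fun ω ↦ f (I.restrict (shiftedSheet W (T ω) · ω))) P :=
    Integrable.of_bound (f.continuous.measurable.comp_aemeasurable (hmeas T hT)).aestronglyMeasurable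
      ‖f‖ (ae_of_all _ fun ω ↦ f.norm_coe_le_norm _)
  have hlim : Tendsto (fun n ↦ ∫ ω in A, f (I.restrict (shiftedSheet W (gridTime S n ω) · ω)) ∂P)
      atTop (𝓝 (∫ ω in A, f (I.restrict (shiftedSheet W (S ω) · ω)) ∂P)) := by
    refine tendsto_integral_of_dominated_convergence (fun _ ↦ ‖f‖)
      (fun n ↦ (hint _ (hgrid n)).aestronglyMeasurable.restrict) (integrable_const _)
      (fun n ↦ ae_of_all _ fun ω ↦ f.norm_coe_le_norm _) (ae_of_all _ fun ω ↦ ?_)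
    refine (f.continuous.tendsto _).comp (tendsto_pi_nhds.2 fun p ↦ ?_)
    have hc : Continuous fun s : ℝ≥0 ↦ shiftedSheet W s p.1 ω :=
      ((hW.continuous ω).comp (f := fun s : ℝ≥0 ↦ (s + p.1.1, p.1.2)) (by fun_prop)).sub
        ((hW.continuous ω).comp (Continuous.prodMk_left p.1.2))
    exact (hc.tendsto _).comp (tendsto_gridTime S ω)
  simp only [fun n ↦ setIntegral_shiftedSheet_gridTime hW hS hA n I f.continuous.measurable
    (hint _ (hgrid n))] at hlim
  exact tendsto_nhds_unique hlim tendsto_const_nhds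

/-- Conditionally on an event of the past of `S`, the increments after `S` have the law of the
sheet. -/
lemma map_increment [IsProbabilityMeasure P] (hW : IsBrownianSheet W P)
    (hS : IsStoppingTime (sheetFiltration hW) (fun ω ↦ (S ω : WithTop ℝ≥0))) {A : Set Λ}
    (hA : MeasurableSet[hS.measurableSpace] A) :
    (P.restrict A).map (fun ω s ↦ increment hW S ω s) =
      P A • P.map (fun ω s ↦ slice hW s ω) := by
  have mW : Measurable fun ω s ↦ slice hW s ω :=
    measurable_pi_lambda _ fun s ↦ measurable_continuousMap fun t ↦ hW.measurable s t
  have mZ : AEMeasurable (fun ω s ↦ increment hW S ω s) (P.restrict A) :=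
    (aemeasurable_increment hW (aemeasurable_stoppingTime hW hS)).restrict
  let e : (ℝ≥0 → C(ℝ≥0, ℝ)) → ℝ≥0 × ℝ≥0 → ℝ := fun f p ↦ f p.1 p.2
  have me : Measurable e := measurable_pi_lambda _ fun p ↦
    (continuous_eval_const _).measurable.comp (measurable_pi_apply p.1)
  have key : ((P.restrict A).map (fun ω s ↦ increment hW S ω s)).map e =
      (P A • P.map (fun ω s ↦ slice hW s ω)).map e := by
    have (I : Finset (ℝ≥0 × ℝ≥0)) : IsFiniteMeasure
        (P A • P.map (fun ω ↦ I.restrict (fun p : ℝ≥0 × ℝ≥0 ↦ W p.1 p.2 ω))) :=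
      Measure.smul_finite _ (measure_ne_top P A)
    -- Both measures are projective limits of the same finite-dimensional family.
    refine IsProjectiveLimit.unique (P := fun I : Finset (ℝ≥0 × ℝ≥0) ↦
      P A • P.map (fun ω ↦ I.restrict (fun p : ℝ≥0 × ℝ≥0 ↦ W p.1 p.2 ω))) (fun I ↦ ?_) fun I ↦ ?_
    · beta_reduce
      rw [← map_restrict_increment hW hS hA I, Measure.map_map (Finset.measurable_restrict I) me,
        AEMeasurable.map_map_of_aemeasurable
          ((Finset.measurable_restrict I).comp me).aemeasurable mZ]
      rfl
    · rw [Measure.map_map (Finset.measurable_restrict I) me, Measure.map_smul,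
        Measure.map_map ((Finset.measurable_restrict I).comp me) mW]
      rfl
  refine Measure.ext fun D hD ↦ ?_
  obtain ⟨D', hD', rfl⟩ := pi_continuousMap_le_comap_uncurry D hD
  rw [← Measure.map_apply me hD', key, Measure.map_apply me hD']

end StoppingTime

/-! ### Independence and restriction to `[0,1]` -/

/-- A process whose law conditionally on every event of a sigma-algebra is a fixed one is
independent of that sigma-algebra. -/
lemma indep_comap_of_map_restrict_eq_smul {Ω E : Type*} {m mΩ : MeasurableSpace Ω}
    {mE : MeasurableSpace E} {P : Measure Ω} [IsProbabilityMeasure P]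
    {Z Y : Ω → E} (hZ : AEMeasurable Z P)
    (hm : ∀ A, MeasurableSet[m] A → NullMeasurableSet A P)
    (h : ∀ A, MeasurableSet[m] A → (P.restrict A).map Z = P A • P.map Y) :
    Indep (mE.comap Z) m P := by
  have hlaw : P.map Z = P.map Y := by simpa using h Set.univ MeasurableSet.univ
  rw [Indep_iff]
  rintro _ A ⟨D, hD, rfl⟩ hA
  have := congrArg (· D) (h A hA)
  simp only [Measure.smul_apply, smul_eq_mul, ← hlaw, Measure.map_apply_of_aemeasurable hZ hD,
    Measure.map_apply_of_aemeasurable hZ.restrict hD, Measure.restrict_apply₀' (hm A hA)] at this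
  rw [this, mul_comm]

lemma measurable_toWiener : Measurable toWiener :=
  (ContinuousMap.continuous_restrict _).measurable

end BrownianSheet

theorem theorem2p1 {Λ : Type*} {mΛ : MeasurableSpace Λ} (P : Measure Λ) [IsProbabilityMeasure P]
    (W : ℝ≥0 → ℝ≥0 → Λ → ℝ) (hW : BrownianSheet.IsBrownianSheet W P)
    (S : Λ → ℝ≥0)
    (hS : IsStoppingTime (BrownianSheet.sheetFiltration hW) (fun ω ↦ (S ω : WithTop ℝ≥0))) :
    -- as random elements of `C([0,∞), ℝ)`
    (Measurable[hS.measurableSpace] (fun ω ↦ BrownianSheet.slice hW (S ω) ω) ∧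
      Indep (MeasurableSpace.comap (fun ω s ↦ BrownianSheet.increment hW S ω s)
        MeasurableSpace.pi) hS.measurableSpace P ∧
      IdentDistrib (fun ω s ↦ BrownianSheet.increment hW S ω s)
        (fun ω s ↦ BrownianSheet.slice hW s ω) P P) ∧
    -- as random elements of `C([0,1], ℝ)`
    (Measurable[hS.measurableSpace]
        (fun ω ↦ BrownianSheet.toWiener (BrownianSheet.slice hW (S ω) ω)) ∧
      Indep (MeasurableSpace.comap
        (fun ω s ↦ BrownianSheet.toWiener (BrownianSheet.increment hW S ω s))
        MeasurableSpace.pi) hS.measurableSpace P ∧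
      IdentDistrib (fun ω s ↦ BrownianSheet.toWiener (BrownianSheet.increment hW S ω s))
        (fun ω s ↦ BrownianSheet.toWiener (BrownianSheet.slice hW s ω)) P P) := by
  open BrownianSheet in
  have hslice := measurable_slice_stoppingTime hW hS
  have mZ : AEMeasurable (fun ω s ↦ increment hW S ω s) P :=
    aemeasurable_increment hW (aemeasurable_stoppingTime hW hS)
  have mY : Measurable fun ω s ↦ slice hW s ω :=
    measurable_pi_lambda _ fun s ↦ measurable_continuousMap fun t ↦ hW.measurable s t
  have hindep : Indep (MeasurableSpace.comap (fun ω s ↦ increment hW S ω s)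
      MeasurableSpace.pi) hS.measurableSpace P :=
    indep_comap_of_map_restrict_eq_smul mZ (fun A hA ↦ hS.measurableSpace_le A hA)
      fun A hA ↦ map_increment hW hS hA
  have hlaw : IdentDistrib (fun ω s ↦ increment hW S ω s) (fun ω s ↦ slice hW s ω) P P :=
    ⟨mZ, mY.aemeasurable, by simpa using map_increment hW hS MeasurableSet.univ⟩
  have hrestrict : Measurable fun (f : ℝ≥0 → C(ℝ≥0, ℝ)) s ↦ toWiener (f s) :=
    measurable_pi_lambda _ fun s ↦ measurable_toWiener.comp (measurable_pi_apply s)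
  refine ⟨⟨hslice, hindep, hlaw⟩, measurable_toWiener.comp hslice,
    indep_of_indep_of_le_left hindep ?_, hlaw.comp hrestrict⟩
  exact (hrestrict.comp (comap_measurable _)).comap_le
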